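/- Let $n\ge 0$, let $\sigma$ be a permutation of $\{1,\dots,n\}$, and let $P_n^\sigma$ be the quandle on $\{0,1,\dots,n\}$ with $x*y=x$ if $y\ne 0$, $x*0=\sigma(x)$ if $x\neq 0$, and $0*0=0$. Let $S\subseteq \mathrm{End}(P_n^\sigma)$ be any set of quandle endomorphisms. For a finite quandle $X$, an $X$-coloring of an oriented link diagram assigns an element of $X$ to every arc so that at every crossing $c' = c*y$, where $y$ is the color of the over arc and $c$, $c'$ are the colors of the under arcs on the right and on the left of the oriented over arc. For $S\subseteq\mathrm{End}(X)$, the quandle quiver $\mathcal{Q}^S_X(L)$ of a link $L$ given by a diagram is the directed multigraph whose vertices are the $X$-colorings of the diagram, with one edge from $v$ to $f\circ v$ for every coloring $v$ and every $f\in S$. Two quivers are isomorphic if there is a bijection between their vertices together with a bijection between their edges that respects sources and targets. The linking number $lk(K_1,K_2)$ of two components is half the number of positive crossings minus the number of negative crossings between $K_1$ and $K_2$ in the diagram. **Theorem.** Let $L=K_1\cup K_2$ and $L'=K_1'\cup K_2'$ be oriented 2-component links in $\mathbb{R}^3$, each given by a diagram (a regular projection, with over/under information, of a polygonal representative of the link).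 If $lk(K_1,K_2)=lk(K_1',K_2')$, then the quivers $\mathcal{Q}^S_{P_n^\sigma}(L)$ and $\mathcal{Q}^S_{P_n^\sigma}(L')$ are isomorphic. -/

import Mathlib

open scoped Quandles

/-! ### The quandles `P_n^σ`

Mathlib writes the quandle operation as a left action: `y ◃ x` is the element usually written
`x * y` in the convention where `y` acts from the right. -/

/-- The underlying set `{0, 1, …, n}` of `P_n^σ`; the positive elements are the `i.succ` with
`i : Fin n`, and `σ` permutes them. -/
def PQuandle (n : ℕ) (_σ : Equiv.Perm (Fin n)) : Type := Fin (n + 1)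

namespace PQuandle

variable {n : ℕ}

/-- The extension of `σ` to `{0, 1, …, n}` that fixes `0`. -/
def extend (σ : Equiv.Perm (Fin n)) (x : Fin (n + 1)) : Fin (n + 1) :=
  Fin.cases 0 (fun i => (σ i).succ) x

/-- `star σ x y` is `x * y`: it is `x` if `y ≠ 0`, it is `σ x` if `y = 0 ≠ x`, and `0 * 0 = 0`. -/
def star (σ : Equiv.Perm (Fin n)) (x y : Fin (n + 1)) : Fin (n + 1) :=
  if y = 0 then extend σ x else x

theorem extend_zero (σ : Equiv.Perm (Fin n)) : extend σ 0 = 0 := rfl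

theorem extend_succ (σ : Equiv.Perm (Fin n)) (i : Fin n) : extend σ i.succ = (σ i).succ := rfl

theorem extend_eq_zero (σ : Equiv.Perm (Fin n)) (x : Fin (n + 1)) : extend σ x = 0 ↔ x = 0 := by
  refine Fin.cases ?_ (fun i => ?_) x
  · simp [extend_zero]
  · simp [extend_succ]

theorem extend_extend_symm (σ : Equiv.Perm (Fin n)) (x : Fin (n + 1)) :
    extend σ (extend σ.symm x) = x := by
  refine Fin.cases ?_ (fun i => ?_) x
  · rfl
  · simp [extend_succ]

theorem extend_symm_extend (σ : Equiv.Perm (Fin n)) (x : Fin (n + 1)) :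
    extend σ.symm (extend σ x) = x := by
  refine Fin.cases ?_ (fun i => ?_) x
  · rfl
  · simp [extend_succ]

theorem star_distrib (σ : Equiv.Perm (Fin n)) (x y z : Fin (n + 1)) :
    star σ (star σ z y) x = star σ (star σ z x) (star σ y x) := by
  unfold star
  by_cases hx : x = 0 <;> by_cases hy : y = 0 <;> simp [hx, hy, extend_eq_zero]

theorem star_symm_star (σ : Equiv.Perm (Fin n)) (x y : Fin (n + 1)) :
    star σ.symm (star σ x y) y = x := by
  unfold star
  by_cases hy : y = 0 <;> simp [hy, extend_symm_extend]

theorem star_star_symm (σ : Equiv.Perm (Fin n)) (x y : Fin (n + 1)) :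
    star σ (star σ.symm x y) y = x := by
  unfold star
  by_cases hy : y = 0 <;> simp [hy, extend_extend_symm]

theorem star_self (σ : Equiv.Perm (Fin n)) (x : Fin (n + 1)) : star σ x x = x := by
  unfold star
  by_cases hx : x = 0 <;> simp [hx, extend_zero]

/-- The quandle `P_n^σ`, with `y ◃ x = x * y`. -/
instance (σ : Equiv.Perm (Fin n)) : Quandle (PQuandle n σ) where
  act y x := star σ x y
  self_distrib {x y z} := star_distrib σ x y z
  invAct y x := star σ.symm x y
  left_inv y x := star_symm_star σ x y
  right_inv y x := star_star_symm σ x y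
  fix {x} := star_self σ x

end PQuandle

/-! ### Oriented links and their diagrams

Links are polygonal links in `ℝ³`, and a link diagram is a regular projection of such a link to the
`xy`-plane together with the over/under information given by the `z`-coordinate. -/

/-- The closed polygon with cyclically ordered vertices `v`, parametrized by `ℝ` with period `n`:
on `[k, k + 1]` it runs linearly from `v k` to `v (k + 1)`. -/
noncomputable def polygonPath {n : ℕ} (v : ZMod n → Fin 3 → ℝ) (s : ℝ) : Fin 3 → ℝ :=
  AffineMap.lineMap (v (⌊s⌋ : ℤ)) (v ((⌊s⌋ : ℤ) + 1)) (Int.fract s)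

/-- An oriented polygonal link in `ℝ³` with `m` components. -/
structure PolygonalLink (m : ℕ) where
  /-- The number of vertices of each component. -/
  len : Fin m → ℕ
  len_pos : ∀ i, 0 < len i
  /-- The vertices of each component, in the cyclic order given by the orientation. -/
  vertex : (i : Fin m) → ZMod (len i) → Fin 3 → ℝ
  /-- The components are simple closed curves, and they are pairwise disjoint. -/
  embedded : ∀ (i j : Fin m) (s t : ℝ), s ∈ Set.Ico 0 (len i : ℝ) → t ∈ Set.Ico 0 (len j : ℝ) →
    polygonPath (vertex i) s = polygonPath (vertex j) t → i = j ∧ s = t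

namespace PolygonalLink

variable {m : ℕ} (L : PolygonalLink m)

/-- The points of the link, given by component and parameter. -/
structure Point where
  comp : Fin m
  param : ℝ
  param_mem : param ∈ Set.Ico 0 (L.len comp : ℝ)

variable {L}

/-- The point in `ℝ³`. -/
noncomputable def Point.pos (p : L.Point) : Fin 3 → ℝ := polygonPath (L.vertex p.comp) p.param

/-- The direction vector of the oriented edge on which the point lies. -/
noncomputable def Point.dir (p : L.Point) : Fin 3 → ℝ :=
  L.vertex p.comp ((⌊p.param⌋ : ℤ) + 1) - L.vertex p.comp (⌊p.param⌋ : ℤ)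

/-- The point is a vertex of the polygon. -/
def Point.IsVertex (p : L.Point) : Prop := Int.fract p.param = 0

/-- The two points have the same projection to the `xy`-plane. -/
def SameProj (p q : L.Point) : Prop := p.pos 0 = q.pos 0 ∧ p.pos 1 = q.pos 1

end PolygonalLink

/-- A diagram of an oriented link with `m` components: a polygonal link whose projection to the
`xy`-plane is regular, that is, has only finitely many multiple points, all of them double points,
and no vertex projects to a double point. -/
structure LinkDiagram (m : ℕ) extends PolygonalLink m where
  finite_multiple : {pq : toPolygonalLink.Point × toPolygonalLink.Point |
    pq.1 ≠ pq.2 ∧ PolygonalLink.SameProj pq.1 pq.2}.Finite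
  double : ∀ p q r : toPolygonalLink.Point, PolygonalLink.SameProj p q →
    PolygonalLink.SameProj p r → p = q ∨ p = r ∨ q = r
  not_vertex : ∀ p q : toPolygonalLink.Point, p ≠ q → PolygonalLink.SameProj p q → ¬ p.IsVertex

namespace LinkDiagram

variable {m : ℕ} (D : LinkDiagram m)

/-- The points of the underlying link. -/
abbrev Point : Type := D.toPolygonalLink.Point

/-- A crossing of the diagram: two points of the link with the same projection, the first one
above the second one. -/
@[ext]
structure Crossing where
  overPt : D.Point
  underPt : D.Point
  sameProj : PolygonalLink.SameProj overPt underPt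
  above : underPt.pos 2 < overPt.pos 2

instance : Finite D.Crossing := by
  have hfin : Finite {pq : D.Point × D.Point //
      pq.1 ≠ pq.2 ∧ PolygonalLink.SameProj pq.1 pq.2} := D.finite_multiple.to_subtype
  refine Finite.of_injective
    (β := {pq : D.Point × D.Point // pq.1 ≠ pq.2 ∧ PolygonalLink.SameProj pq.1 pq.2})
    (fun c => ⟨(c.overPt, c.underPt), ?_, c.sameProj⟩) ?_
  · intro h
    have h' := c.above
    rw [show c.overPt = c.underPt from h] at h'
    exact lt_irrefl _ h'
  · intro c c' h
    simp only [Subtype.mk.injEq, Prod.mk.injEq] at h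
    exact Crossing.ext h.1 h.2

variable {D}

/-- The sign of a crossing: `+1` if the over strand is turned counterclockwise (by less than a half
turn) to the direction of the under strand, and `-1` if it is turned clockwise. -/
noncomputable def Crossing.sign (c : D.Crossing) : SignType :=
  SignType.sign (c.overPt.dir 0 * c.underPt.dir 1 - c.overPt.dir 1 * c.underPt.dir 0)

variable (D)

/-- The linking number of two different components: half of the number of positive crossings minus
the number of negative crossings between them. -/
noncomputable def linkingNumber (i j : Fin m) : ℚ :=
  (∑ᶠ c : {c : D.Crossing // (c.overPt.comp = i ∧ c.underPt.comp = j) ∨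
    (c.overPt.comp = j ∧ c.underPt.comp = i)}, ((c.1.sign : ℤ) : ℚ)) / 2

/-- The parameter `s : ℝ` on the `i`-th component (periodic with period `len i`) is the lower point
of a crossing. -/
def IsUnder (i : Fin m) (s : ℝ) : Prop :=
  ∃ c : D.Crossing, c.underPt.comp = i ∧ ∃ k : ℤ, s = c.underPt.param + k * D.len i

/-- The position of a point of the diagram that is not an undercrossing. The parameter may be any
real number, so that a point of the diagram has many positions, which differ by multiples of the
period. -/
structure Position where
  comp : Fin m
  param : ℝ
  not_under : ¬ D.IsUnder comp param

/-- One can go from `p` to `q` along the orientation without passing an undercrossing, or `p` and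
`q` are the same point of the diagram, with parameters that differ by the period. -/
def Position.Rel (p q : D.Position) : Prop :=
  p.comp = q.comp ∧
    ((p.param ≤ q.param ∧ ∀ s ∈ Set.Icc p.param q.param, ¬ D.IsUnder p.comp s) ∨
      q.param = p.param + D.len p.comp)

/-- The arcs of the diagram, which run from an undercrossing to the next one (or are a whole
component, if it has no undercrossing). -/
def Arc : Type := Quot (Position.Rel D)

variable {D}

/-- The arc on which a position lies. -/
def Position.arc (p : D.Position) : D.Arc := Quot.mk _ p

theorem Crossing.over_not_under (c : D.Crossing) :
    ¬ D.IsUnder c.overPt.comp c.overPt.param := by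
  rintro ⟨c', hc, k, hk⟩
  have hpt : c'.underPt = c.overPt := by
    have h1 := c.overPt.param_mem
    have h2 := c'.underPt.param_mem
    rw [hc] at h2
    have hl : (0 : ℝ) < D.len c.overPt.comp := by exact_mod_cast D.len_pos _
    have hk0 : k = 0 := by
      have a : (k : ℝ) < 1 := by
        by_contra h
        nlinarith [h1.1, h1.2, h2.1, h2.2]
      have b : (-1 : ℝ) < k := by
        by_contra h
        nlinarith [h1.1, h1.2, h2.1, h2.2]
      have a' : k < 1 := by exact_mod_cast a
      have b' : -1 < k := by exact_mod_cast b
      omega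
    have hp : c.overPt.param = c'.underPt.param := by simpa [hk0] using hk
    generalize c.overPt = p at *
    generalize c'.underPt = q at *
    cases p
    cases q
    simp only at hc hp
    subst hc hp
    rfl
  have h1 := c.above
  have h2 := c'.above
  have hs : PolygonalLink.SameProj c.overPt c'.overPt := by
    have h := c'.sameProj
    rw [hpt] at h
    exact ⟨h.1.symm, h.2.symm⟩
  rw [hpt] at h2
  rcases D.double _ _ _ c.sameProj hs with h | h | h
  · rw [← h] at h1
    exact lt_irrefl _ h1
  · rw [← h] at h2
    exact lt_irrefl _ h2
  · rw [← h] at h2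
    exact lt_asymm h1 h2

/-- The over arc of a crossing. -/
def Crossing.overArc (c : D.Crossing) : D.Arc :=
  Position.arc ⟨c.overPt.comp, c.overPt.param, c.over_not_under⟩

/-- `a` is the under arc that ends at the crossing. -/
def Crossing.IsIncoming (c : D.Crossing) (a : D.Arc) : Prop :=
  ∃ p : D.Position, p.comp = c.underPt.comp ∧ p.param < c.underPt.param ∧
    (∀ s ∈ Set.Ico p.param c.underPt.param, ¬ D.IsUnder c.underPt.comp s) ∧ a = p.arc

/-- `a` is the under arc that starts at the crossing. -/
def Crossing.IsOutgoing (c : D.Crossing) (a : D.Arc) : Prop :=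
  ∃ p : D.Position, p.comp = c.underPt.comp ∧ c.underPt.param < p.param ∧
    (∀ s ∈ Set.Ioc c.underPt.param p.param, ¬ D.IsUnder c.underPt.comp s) ∧ a = p.arc

/-! ### Quandle colorings and the quandle quiver -/

variable (D)

/-- An `X`-coloring of the diagram: if the over arc of a crossing has color `y`, and `x`, `x'` are
the colors of the under arcs to the right and to the left of the oriented over arc, then
`x' = x * y`. At a positive crossing the under strand runs from right to left, and at a
negative crossing from left to right. -/
@[ext]
structure Coloring (X : Type*) [Quandle X] where
  color : D.Arc → X
  positive : ∀ (c : D.Crossing) (a b : D.Arc), c.IsIncoming a → c.IsOutgoing b → c.sign = 1 →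
    color b = color c.overArc ◃ color a
  negative : ∀ (c : D.Crossing) (a b : D.Arc), c.IsIncoming a → c.IsOutgoing b → c.sign = -1 →
    color a = color c.overArc ◃ color b

variable {D}

/-- A quandle endomorphism acts on colorings by replacing the colors by their images. -/
def Coloring.map {X : Type*} [Quandle X] (f : X →◃ X) (c : D.Coloring X) : D.Coloring X where
  color a := f (c.color a)
  positive x a b ha hb hs := by rw [c.positive x a b ha hb hs, f.map_act]
  negative x a b ha hb hs := by rw [c.negative x a b ha hb hs, f.map_act]

variable (D)

/-- The vertices of the quandle quiver of the diagram: the `X`-colorings. -/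
def QuandleQuiver (X : Type*) [Quandle X] (_S : Set (X →◃ X)) : Type _ := D.Coloring X

/-- The quandle quiver has, for every coloring `v` and every `f ∈ S`, one edge from `v` to its image
under `f`. -/
instance (X : Type*) [Quandle X] (S : Set (X →◃ X)) : Quiver (D.QuandleQuiver X S) where
  Hom v w := {f : S // Coloring.map f.1 v = w}

end LinkDiagram

/-- An isomorphism of quivers: a bijection between the vertices together with a bijection between the
edges that is compatible with sources and targets. -/
structure QuiverIso (V W : Type*) [Quiver V] [Quiver W] where
  onVertices : V ≃ W
  onEdges : ∀ v w : V, (v ⟶ w) ≃ (onVertices v ⟶ onVertices w)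

/-! In `P_n^σ` an action never turns `0` into a nonzero element or conversely, so each component is
colored entirely by `0` or entirely by nonzero elements. Passing under a nonzero color changes
nothing; passing under `0` applies the extension of `σ` or its inverse, according to the sign. A
coloring is therefore determined by one base color `x i` per component (`color_eq_baseColor`), and a
tuple `x` comes from a coloring iff every `x i` returns to itself after a full turn (`Admissible`,
`coloringEquiv`).

The exponent of that turn is the sum of `overSum j i` over the components `j` colored `0`. If `x i =
0` the condition is empty; otherwise `j ≠ i`, so self-crossings play no role
(`admissible_iff_of_overSum_eq`). For `j ≠ i`, `overSum j i` is the linking number: two closed plane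
polygons have algebraic intersection number `0`, so the signed crossings with `i` above and with `j`
above have equal sums (`overSum_comm`). Equal linking numbers thus give the same admissible tuples,
and since endomorphisms act on base colors coordinatewise, matching base colors is an isomorphism of
quivers.

The vanishing of the intersection number is proved by winding numbers. Edges of `p` and `q` meet iff
the parallelogram of differences `p - q` contains the origin, and then its boundary winds once
around it, with the sign of the crossing. Summed over all pairs of edges, the boundary contributions
cancel. -/

/-! ### Intersection numbers of closed polygons in the plane -/

namespace PlanarPolygon

/-- The determinant of two plane vectors. -/
def cross (u v : ℝ × ℝ) : ℝ := u.1 * v.2 - u.2 * v.1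

/-- The signed number of times the segment from `u` to `v` crosses the positive `x`-axis, counted
positively in the counterclockwise direction. -/
noncomputable def axisCross (u v : ℝ × ℝ) : ℤ :=
  if u.2 < 0 ∧ 0 ≤ v.2 ∧ 0 < cross u v then 1
  else if 0 ≤ u.2 ∧ v.2 < 0 ∧ cross u v < 0 then -1 else 0

theorem cross_swap (u v : ℝ × ℝ) : cross v u = -cross u v := by
  unfold cross; ring

theorem axisCross_swap (u v : ℝ × ℝ) : axisCross v u = -axisCross u v := by
  unfold axisCross
  rw [cross_swap u v]
  by_cases h1 : u.2 < 0 <;> by_cases h2 : v.2 < 0 <;>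
    simp [h1, h2, not_lt.1, not_le.2]
  · grind
  · grind

/-- The indicator of the closed upper half plane. -/
noncomputable def upper (u : ℝ × ℝ) : ℤ := if 0 ≤ u.2 then 1 else 0

/-- In a convex set that misses the origin, the crossings with the positive `x`-axis only depend on
the half planes in which the end points lie. -/
theorem axisCross_eq_of_convex {K : Set (ℝ × ℝ)} (hK : Convex ℝ K) (h0 : (0 : ℝ × ℝ) ∉ K) :
    ∃ β : ℤ, ∀ u ∈ K, ∀ v ∈ K, axisCross u v = β * (upper v - upper u) := by
  -- the point where a straddling segment meets the axis
  have meet : ∀ u ∈ K, ∀ v ∈ K, u.2 < 0 → 0 ≤ v.2 →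
      ((cross u v / (v.2 - u.2), 0) : ℝ × ℝ) ∈ K := by
    intro u hu v hv h1 h2
    have hd : 0 < v.2 - u.2 := by linarith
    have := hK hu hv (a := v.2 / (v.2 - u.2)) (b := -u.2 / (v.2 - u.2)) (by positivity)
      (div_nonneg (by linarith) hd.le) (by field_simp; ring)
    convert this using 1
    ext
    · simp [cross]; field_simp; ring
    · simp; field_simp; ring
  -- If the axis met `K` both at a positive and at a nonpositive point, convexity would put the
  -- origin into `K`.
  have key : ∀ x y : ℝ, ((x, 0) : ℝ × ℝ) ∈ K → ((y, 0) : ℝ × ℝ) ∈ K → 0 < x → 0 < y := by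
    intro x y hx hy hpos
    by_contra hneg
    push Not at hneg
    apply h0
    have hd : 0 < x - y := by linarith
    have := hK hx hy (a := -y / (x - y)) (b := x / (x - y)) (div_nonneg (by linarith) hd.le)
      (by positivity) (by field_simp; ring)
    convert this using 1
    ext
    · simp; field_simp; ring
    · simp
  have up : ∃ β : ℤ, ∀ u ∈ K, ∀ v ∈ K, u.2 < 0 → 0 ≤ v.2 → axisCross u v = β := by
    by_cases hex : ∃ x : ℝ, 0 < x ∧ ((x, 0) : ℝ × ℝ) ∈ K
    · obtain ⟨x, hx, hxK⟩ := hex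
      refine ⟨1, fun u hu v hv h1 h2 => ?_⟩
      have := key _ _ hxK (meet u hu v hv h1 h2) hx
      have hc : 0 < cross u v := by
        rwa [div_pos_iff_of_pos_right (by linarith)] at this
      simp [axisCross, h1, h2, hc]
    · push Not at hex
      refine ⟨0, fun u hu v hv h1 h2 => ?_⟩
      have hc : ¬ 0 < cross u v := fun hc =>
        hex _ (div_pos hc (by linarith)) (meet u hu v hv h1 h2)
      simp [axisCross, h1, h2, hc, not_le.2]
  obtain ⟨β, hβ⟩ := up
  refine ⟨β, fun u hu v hv => ?_⟩
  rcases lt_or_ge u.2 0 with h1 | h1 <;> rcases lt_or_ge v.2 0 with h2 | h2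
  · simp [axisCross, upper, h1, h2, not_le.2 h1, not_le.2 h2]
  · rw [hβ u hu v hv h1 h2]
    simp [upper, h2, not_le.2 h1]
  · rw [axisCross_swap, hβ v hv u hu h2 h1]
    simp [upper, h1, not_le.2 h2]
  · simp [axisCross, upper, h1, h2, not_lt.2 h1, not_lt.2 h2]

/-- The number of turns of the parallelogram with vertices `u`, `u + A`, `u + A + B`, `u + B` around
the origin. -/
noncomputable def turns (u A B : ℝ × ℝ) : ℤ :=
  axisCross u (u + A) + axisCross (u + A) (u + A + B) + axisCross (u + A + B) (u + B) +
    axisCross (u + B) u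

/-- The parallelogram is convex and misses the origin, so each side contributes a constant times the
change of `upper`, and these changes cancel around the boundary. -/
theorem turns_eq_zero {u A B : ℝ × ℝ}
    (h : ∀ s ∈ Set.Icc (0 : ℝ) 1, ∀ t ∈ Set.Icc (0 : ℝ) 1, u + s • A + t • B ≠ 0) :
    turns u A B = 0 := by
  set K : Set (ℝ × ℝ) := (fun z : ℝ × ℝ => u + z.1 • A + z.2 • B) ''
    (Set.Icc (0 : ℝ) 1 ×ˢ Set.Icc (0 : ℝ) 1) with hKdef
  have hK : Convex ℝ K := by
    rintro _ ⟨x, hx, rfl⟩ _ ⟨y, hy, rfl⟩ a b ha hb hab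
    refine ⟨a • x + b • y, ((convex_Icc (0 : ℝ) 1).prod (convex_Icc (0 : ℝ) 1)) hx hy ha hb hab, ?_⟩
    obtain rfl : b = 1 - a := by linarith
    ext <;> simp <;> ring
  have h0 : (0 : ℝ × ℝ) ∉ K := by
    rintro ⟨x, hx, hx0⟩
    exact h x.1 hx.1 x.2 hx.2 hx0
  obtain ⟨β, hβ⟩ := axisCross_eq_of_convex hK h0
  have m0 : u ∈ K := ⟨(0, 0), by simp, by simp⟩
  have m1 : u + A ∈ K := ⟨(1, 0), by simp, by simp⟩
  have m2 : u + A + B ∈ K := ⟨(1, 1), by simp, by simp⟩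
  have m3 : u + B ∈ K := ⟨(0, 1), by simp, by simp⟩
  rw [turns, hβ _ m0 _ m1, hβ _ m1 _ m2, hβ _ m2 _ m3, hβ _ m3 _ m0]
  ring

/-- Seen from an interior origin, the determinants of successive corners are positive multiples of
`cross A B`, so the boundary always turns the same way. It crosses the `x`-axis once upward and once
downward, and only one of these crossings is on the positive half. -/
theorem turns_eq_sign {u A B : ℝ × ℝ} {s t : ℝ} (hs : s ∈ Set.Ioo (0 : ℝ) 1)
    (ht : t ∈ Set.Ioo (0 : ℝ) 1) (h : u + s • A + t • B = 0) (hD : cross A B ≠ 0) :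
    turns u A B = (SignType.sign (cross A B) : ℤ) := by
  obtain ⟨s0, s1⟩ := hs
  obtain ⟨t0, t1⟩ := ht
  obtain ⟨u1, u2⟩ := u
  obtain ⟨a1, a2⟩ := A
  obtain ⟨b1, b2⟩ := B
  have e1 : u1 = -(s * a1) - t * b1 := by
    have := congrArg Prod.fst h; simp at this; linarith
  have e2 : u2 = -(s * a2) - t * b2 := by
    have := congrArg Prod.snd h; simp at this; linarith
  set D := cross (a1, a2) (b1, b2) with hDdef
  have c01 : cross (u1, u2) ((u1, u2) + (a1, a2)) = t * D := by
    simp [cross, hDdef, e1, e2]; ring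
  have c12 : cross ((u1, u2) + (a1, a2)) ((u1, u2) + (a1, a2) + (b1, b2)) = (1 - s) * D := by
    simp [cross, hDdef, e1, e2]; ring
  have c23 : cross ((u1, u2) + (a1, a2) + (b1, b2)) ((u1, u2) + (b1, b2)) = (1 - t) * D := by
    simp [cross, hDdef, e1, e2]; ring
  have c30 : cross ((u1, u2) + (b1, b2)) (u1, u2) = s * D := by
    simp [cross, hDdef, e1, e2]; ring
  have s1' : 0 < 1 - s := by linarith
  have t1' : 0 < 1 - t := by linarith
  -- The origin is a weighted mean of the corners with positive weights, so the corners cannot all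
  -- lie in one half plane of `upper`.
  have havg : (1 - s) * (1 - t) * u2 + s * (1 - t) * (u2 + a2) + s * t * (u2 + a2 + b2) +
      (1 - s) * t * (u2 + b2) = 0 := by rw [e2]; ring
  have hpos : ¬ (0 ≤ u2 ∧ 0 ≤ u2 + a2 ∧ 0 ≤ u2 + a2 + b2 ∧ 0 ≤ u2 + b2) := by
    rintro ⟨h0, h1, h2, h3⟩
    have p0 : 0 < (1 - s) * (1 - t) := by positivity
    have p1 : 0 < s * (1 - t) := by positivity
    have p2 : 0 < s * t := by positivity
    have p3 : 0 < (1 - s) * t := by positivity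
    have q0 := mul_nonneg p0.le h0
    have q1 := mul_nonneg p1.le h1
    have q2 := mul_nonneg p2.le h2
    have q3 := mul_nonneg p3.le h3
    have z0 : u2 = 0 := by
      rcases mul_eq_zero.1 (show (1 - s) * (1 - t) * u2 = 0 by linarith) with h | h
      · linarith
      · exact h
    have z1 : u2 + a2 = 0 := by
      rcases mul_eq_zero.1 (show s * (1 - t) * (u2 + a2) = 0 by linarith) with h | h
      · linarith
      · exact h
    have z3 : u2 + b2 = 0 := by
      rcases mul_eq_zero.1 (show (1 - s) * t * (u2 + b2) = 0 by linarith) with h | h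
      · linarith
      · exact h
    apply hD
    have ha : a2 = 0 := by linarith
    have hb : b2 = 0 := by linarith
    simp [hDdef, cross, ha, hb]
  have hneg : ¬ (u2 < 0 ∧ u2 + a2 < 0 ∧ u2 + a2 + b2 < 0 ∧ u2 + b2 < 0) := by
    rintro ⟨h0, h1, h2, h3⟩
    have q0 := mul_neg_of_pos_of_neg (show 0 < (1 - s) * (1 - t) by positivity) h0
    have q1 := mul_neg_of_pos_of_neg (show 0 < s * (1 - t) by positivity) h1
    have q2 := mul_neg_of_pos_of_neg (show 0 < s * t by positivity) h2
    have q3 := mul_neg_of_pos_of_neg (show 0 < (1 - s) * t by positivity) h3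
    linarith
  unfold turns axisCross
  rw [c01, c12, c23, c30]
  simp only [Prod.mk_add_mk]
  rcases lt_or_gt_of_ne hD with hD' | hD'
  · have d0 := mul_neg_of_pos_of_neg t0 hD'
    have d1 := mul_neg_of_pos_of_neg s1' hD'
    have d2 := mul_neg_of_pos_of_neg t1' hD'
    have d3 := mul_neg_of_pos_of_neg s0 hD'
    rw [sign_neg hD']
    simp only [d0, d1, d2, d3, not_lt.2 d0.le, not_lt.2 d1.le, not_lt.2 d2.le, not_lt.2 d3.le,
      and_false, and_true, if_false]
    clear havg c01 c12 c23 c30 e1 e2 h d0 d1 d2 d3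
    -- Alternating corners are impossible, because the two pairs of opposite corners have the same
    -- sum.
    by_cases h0 : u2 < 0 <;> by_cases h1 : u2 + a2 < 0 <;> by_cases h2 : u2 + a2 + b2 < 0 <;>
      by_cases h3 : u2 + b2 < 0 <;>
      first
      | (exfalso; first | linarith | exact hneg ⟨h0, h1, h2, h3⟩ |
          exact hpos ⟨not_lt.1 h0, not_lt.1 h1, not_lt.1 h2, not_lt.1 h3⟩)
      | simp [h0, h1, h2, h3, not_lt.1, not_le.2]
  · have d0 := mul_pos t0 hD'
    have d1 := mul_pos s1' hD'
    have d2 := mul_pos t1' hD'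
    have d3 := mul_pos s0 hD'
    rw [sign_pos hD']
    simp only [d0, d1, d2, d3, not_lt.2 d0.le, not_lt.2 d1.le, not_lt.2 d2.le, not_lt.2 d3.le,
      and_false, and_true, if_false]
    clear havg c01 c12 c23 c30 e1 e2 h d0 d1 d2 d3
    by_cases h0 : u2 < 0 <;> by_cases h1 : u2 + a2 < 0 <;> by_cases h2 : u2 + a2 + b2 < 0 <;>
      by_cases h3 : u2 + b2 < 0 <;>
      first
      | (exfalso; first | linarith | exact hneg ⟨h0, h1, h2, h3⟩ |
          exact hpos ⟨not_lt.1 h0, not_lt.1 h1, not_lt.1 h2, not_lt.1 h3⟩)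
      | simp [h0, h1, h2, h3, not_lt.1, not_le.2]

/-- The parallelograms form a grid: a side shared by neighbors is run through in both directions,
and the outer sides cancel because both polygons close up. -/
theorem sum_turns_eq_zero {l m : ℕ} {p q : ℕ → ℝ × ℝ} (hp : p l = p 0) (hq : q m = q 0) :
    ∑ i ∈ Finset.range l, ∑ j ∈ Finset.range m,
      turns (p i - q j) (p (i + 1) - p i) (q j - q (j + 1)) = 0 := by
  have h : ∀ i j, turns (p i - q j) (p (i + 1) - p i) (q j - q (j + 1)) =
      (axisCross (p (i + 1) - q j) (p (i + 1) - q (j + 1)) -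
        axisCross (p i - q j) (p i - q (j + 1))) -
      (axisCross (p i - q (j + 1)) (p (i + 1) - q (j + 1)) -
        axisCross (p i - q j) (p (i + 1) - q j)) := by
    intro i j
    have e1 : p i - q j + (p (i + 1) - p i) = p (i + 1) - q j := by abel
    have e2 : p (i + 1) - q j + (q j - q (j + 1)) = p (i + 1) - q (j + 1) := by abel
    have e3 : p i - q j + (q j - q (j + 1)) = p i - q (j + 1) := by abel
    rw [turns, e1, e2, e3, axisCross_swap (p i - q (j + 1)) (p (i + 1) - q (j + 1)),
      axisCross_swap (p i - q j) (p i - q (j + 1))]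
    ring
  simp_rw [h, Finset.sum_sub_distrib (s := Finset.range m)]
  rw [Finset.sum_sub_distrib,
    Finset.sum_range_sub (fun i => ∑ j ∈ Finset.range m, axisCross (p i - q j) (p i - q (j + 1)))]
  simp_rw [← Finset.sum_sub_distrib]
  have : ∀ i, ∑ j ∈ Finset.range m, (axisCross (p i - q (j + 1)) (p (i + 1) - q (j + 1)) -
      axisCross (p i - q j) (p (i + 1) - q j)) = 0 := by
    intro i
    rw [Finset.sum_range_sub (fun j => axisCross (p i - q j) (p (i + 1) - q j)), hq, sub_self]
  simp [this, hp]

end PlanarPolygon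

/-! ### Signs of crossings and the two ways to count the linking number -/

theorem polygonPath_apply {n : ℕ} (v : ZMod n → Fin 3 → ℝ) (s : ℝ) (k : Fin 3) :
    polygonPath v s k =
      v (⌊s⌋ : ℤ) k + Int.fract s * (v ((⌊s⌋ : ℤ) + 1) k - v (⌊s⌋ : ℤ) k) := by
  simp [polygonPath, AffineMap.lineMap_apply]; ring

theorem polygonPath_apply_of_floor_eq {n : ℕ} (v : ZMod n → Fin 3 → ℝ) {s t : ℝ}
    (h : ⌊s⌋ = ⌊t⌋) (k : Fin 3) :
    polygonPath v s k =
      polygonPath v t k + (s - t) * (v ((⌊t⌋ : ℤ) + 1) k - v (⌊t⌋ : ℤ) k) := by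
  rw [polygonPath_apply, polygonPath_apply, h, Int.fract, Int.fract, h]; ring

namespace PolygonalLink

variable {m : ℕ} {L : PolygonalLink m}

theorem Point.ext {p q : L.Point} (hc : p.comp = q.comp) (hp : p.param = q.param) : p = q := by
  cases p
  cases q
  simp only at hc hp
  subst hc hp
  rfl

theorem SameProj.symm {p q : L.Point} (h : SameProj p q) : SameProj q p :=
  ⟨h.1.symm, h.2.symm⟩

theorem Point.eq_of_pos_eq {p q : L.Point} (h : p.pos = q.pos) : p = q := by
  obtain ⟨hc, hp⟩ := L.embedded _ _ _ _ p.param_mem q.param_mem h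
  exact Point.ext hc hp

theorem SameProj.pos_two_ne {p q : L.Point} (h : SameProj p q) (hne : p ≠ q) :
    p.pos 2 ≠ q.pos 2 := by
  intro h2
  apply hne
  apply Point.eq_of_pos_eq
  ext k
  fin_cases k
  · exact h.1
  · exact h.2
  · exact h2

theorem Point.floor_nonneg (p : L.Point) : 0 ≤ ⌊p.param⌋ := Int.floor_nonneg.2 p.param_mem.1

theorem Point.floor_add_one_le (p : L.Point) : (⌊p.param⌋ : ℝ) + 1 ≤ L.len p.comp := by
  have h : ⌊p.param⌋ < (L.len p.comp : ℤ) := Int.floor_lt.2 (by exact_mod_cast p.param_mem.2)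
  exact_mod_cast h

theorem Point.pos_apply (p : L.Point) (k : Fin 3) :
    p.pos k = L.vertex p.comp (⌊p.param⌋ : ℤ) k + Int.fract p.param * p.dir k :=
  polygonPath_apply _ _ _

/-- The projection of a vertex to the plane. -/
def planeVertex (L : PolygonalLink m) (i : Fin m) (a : ℕ) : ℝ × ℝ :=
  (L.vertex i a 0, L.vertex i a 1)

theorem planeVertex_len (i : Fin m) : L.planeVertex i (L.len i) = L.planeVertex i 0 := by
  simp [planeVertex]

theorem Point.exists_edge (p : L.Point) : ∃ a < L.len p.comp, ∃ r ∈ Set.Ico (0 : ℝ) 1,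
    p.param = a + r ∧ Int.fract p.param = r ∧ ⌊p.param⌋₊ = a ∧
    (p.pos 0, p.pos 1) =
      L.planeVertex p.comp a + r • (L.planeVertex p.comp (a + 1) - L.planeVertex p.comp a) ∧
    (p.dir 0, p.dir 1) = L.planeVertex p.comp (a + 1) - L.planeVertex p.comp a := by
  have hf : ((⌊p.param⌋₊ : ℕ) : ℤ) = ⌊p.param⌋ := Int.natCast_floor_eq_floor p.param_mem.1
  have hz : ((⌊p.param⌋ : ℤ) : ZMod (L.len p.comp)) = (⌊p.param⌋₊ : ℕ) := by
    rw [← hf, Int.cast_natCast]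
  refine ⟨⌊p.param⌋₊, (Nat.floor_lt p.param_mem.1).2 p.param_mem.2, Int.fract p.param,
    ⟨Int.fract_nonneg _, Int.fract_lt_one _⟩, ?_, rfl, rfl, ?_, ?_⟩
  · have := Int.floor_add_fract p.param
    rw [← hf] at this
    exact_mod_cast this.symm
  · ext
    · simp [Point.pos_apply, Point.dir, planeVertex, hz]
    · simp [Point.pos_apply, Point.dir, planeVertex, hz]
  · ext
    · simp [Point.dir, planeVertex, hz]
    · simp [Point.dir, planeVertex, hz]

/-- The closed interval is needed since `turns_eq_zero` concerns the closed parallelogram; at a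
double point `not_vertex` rules out the vertex alternative. -/
theorem exists_point_on_edge {i : Fin m} {a : ℕ} (ha : a < L.len i) {s : ℝ}
    (hs : s ∈ Set.Icc (0 : ℝ) 1) : ∃ p : L.Point, p.comp = i ∧
      (p.pos 0, p.pos 1) =
        L.planeVertex i a + s • (L.planeVertex i (a + 1) - L.planeVertex i a) ∧
      (p.IsVertex ∨ ⌊p.param⌋₊ = a) := by
  rcases hs.2.lt_or_eq with h1 | rfl
  · have hmem : (a + s : ℝ) ∈ Set.Ico 0 (L.len i : ℝ) := by
      have : (a : ℝ) + 1 ≤ L.len i := by exact_mod_cast ha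
      exact ⟨by have := hs.1; positivity, by linarith⟩
    have hfl : ⌊(a + s : ℝ)⌋ = (a : ℤ) :=
      Int.floor_eq_iff.2 ⟨by simpa using hs.1, by simpa using h1⟩
    have hfr : Int.fract (a + s : ℝ) = s := by simp [Int.fract, hfl]
    refine ⟨⟨i, a + s, hmem⟩, rfl, ?_, Or.inr ?_⟩
    · ext <;> simp [Point.pos_apply, Point.dir, planeVertex, hfl, hfr]
    · exact (Nat.floor_eq_iff hmem.1).2 ⟨by simpa using hs.1, by simpa using h1⟩
  -- The end of an edge is the next vertex; on the last edge that is the vertex with parameter `0`.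
  · rcases (Nat.succ_le_of_lt ha).lt_or_eq with h2 | h2
    · refine ⟨⟨i, ((a + 1 : ℕ) : ℝ), ⟨by positivity, by exact_mod_cast h2⟩⟩, rfl, ?_, Or.inl ?_⟩
      · ext <;> simp [Point.pos_apply, planeVertex, -Nat.cast_add, Int.fract_natCast] <;> simp
      · exact Int.fract_natCast _
    · refine ⟨⟨i, 0, ⟨le_rfl, by exact_mod_cast L.len_pos i⟩⟩, rfl, ?_, Or.inl ?_⟩
      · have : L.planeVertex i (a + 1) = L.planeVertex i 0 := by
          rw [← planeVertex_len, ← h2]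
        rw [this]
        ext <;> simp [Point.pos_apply, planeVertex]
      · exact Int.fract_zero

end PolygonalLink

namespace LinkDiagram

open PolygonalLink PlanarPolygon

variable {m : ℕ} {D : LinkDiagram m}

noncomputable instance : Fintype D.Crossing := Fintype.ofFinite _

theorem Crossing.over_ne_under (c : D.Crossing) : c.overPt ≠ c.underPt := by
  intro h
  have h' := c.above
  rw [h] at h'
  exact lt_irrefl _ h'

/-- Two crossings with the same lower point are equal. -/
theorem Crossing.eq_of_underPt_eq {c c' : D.Crossing} (h : c.underPt = c'.underPt) : c = c' := by
  have h' : c.overPt = c'.overPt := by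
    rcases D.double c.underPt c.overPt c'.overPt c.sameProj.symm
      (h ▸ c'.sameProj.symm) with h1 | h1 | h1
    · exact absurd h1.symm c.over_ne_under
    · exact absurd (h ▸ h1).symm c'.over_ne_under
    · exact h1
  exact Crossing.ext h' h

/-- For parallel strands, `α` and `β` are speeds at which both points can move while their
projections stay equal. -/
theorem exists_parallel {a b c d : ℝ} (h : a * d - b * c = 0) :
    ∃ α β : ℝ, (α ≠ 0 ∨ β ≠ 0) ∧ α * a = β * c ∧ α * b = β * d := by
  by_cases h0 : a = 0 ∧ b = 0
  · exact ⟨1, 0, Or.inl one_ne_zero, by simp [h0.1], by simp [h0.2]⟩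
  · refine ⟨a * c + b * d, a * a + b * b, Or.inr ?_, ?_, ?_⟩
    · intro h1
      exact h0 (mul_self_add_mul_self_eq_zero.1 h1)
    · linear_combination b * h
    · linear_combination -a * h

/-- The strands of a crossing are not parallel, because the diagram has only finitely many multiple
points. -/
theorem Crossing.det_ne_zero (c : D.Crossing) :
    c.overPt.dir 0 * c.underPt.dir 1 - c.overPt.dir 1 * c.underPt.dir 0 ≠ 0 := by
  intro hdet
  obtain ⟨α, β, hne, h0, h1⟩ := exists_parallel hdet
  set p := c.overPt with hp
  set q := c.underPt with hq
  have hpq : p ≠ q := c.over_ne_under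
  have inner : ∀ x : D.Point, ¬ x.IsVertex →
      x.param ∈ Set.Ioo (⌊x.param⌋ : ℝ) (⌊x.param⌋ + 1) := fun x hx =>
    ⟨lt_of_le_of_ne (Int.floor_le _) fun h => hx (sub_eq_zero.2 h.symm),
      Int.lt_floor_add_one _⟩
  have cont : ∀ (x : D.Point) (γ : ℝ), ¬ x.IsVertex →
      ∀ᶠ ε : ℝ in nhds 0, x.param + ε * γ ∈ Set.Ioo (⌊x.param⌋ : ℝ) (⌊x.param⌋ + 1) := by
    intro x γ hx
    have hc : Filter.Tendsto (fun ε : ℝ => x.param + ε * γ) (nhds 0) (nhds x.param) := by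
      have : Continuous fun ε : ℝ => x.param + ε * γ := by fun_prop
      simpa using this.tendsto 0
    exact hc.eventually (Ioo_mem_nhds (inner x hx).1 (inner x hx).2)
  have distinct : ∀ᶠ ε : ℝ in nhds 0,
      p.comp = q.comp → p.param + ε * α ≠ q.param + ε * β := by
    by_cases hc : p.comp = q.comp
    · have hpar : p.param + 0 * α ≠ q.param + 0 * β := by
        simpa using fun h => hpq (Point.ext hc h)
      have c1 : ContinuousAt (fun ε : ℝ => p.param + ε * α) 0 := by fun_prop
      have c2 : ContinuousAt (fun ε : ℝ => q.param + ε * β) 0 := by fun_prop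
      exact ((c1.sub c2).eventually_ne (sub_ne_zero.2 hpar)).mono fun ε h _ => sub_ne_zero.1 h
    · exact Filter.Eventually.of_forall fun ε h => absurd h hc
  -- For all small `ε` the moved points stay on their edges and remain distinct, which yields
  -- infinitely many double points.
  have good := (cont p α (D.not_vertex p q hpq c.sameProj)).and
    ((cont q β (D.not_vertex q p hpq.symm c.sameProj.symm)).and distinct)
  have hinf : Set.Infinite _ := infinite_of_mem_nhds (0 : ℝ) good
  refine hinf ?_
  have hfin := D.finite_multiple.image fun pq : D.Point × D.Point => (pq.1.param, pq.2.param)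
  refine Set.Finite.of_finite_image
    (f := fun ε : ℝ => (p.param + ε * α, q.param + ε * β)) (hfin.subset ?_) ?_
  · rintro _ ⟨ε, ⟨hα, hβ, hd⟩, rfl⟩
    have mem : ∀ (x : D.Point) (y : ℝ), y ∈ Set.Ioo (⌊x.param⌋ : ℝ) (⌊x.param⌋ + 1) →
        y ∈ Set.Ico 0 (D.len x.comp : ℝ) := by
      intro x y hy
      have h1 : (0 : ℝ) ≤ ⌊x.param⌋ := by exact_mod_cast x.floor_nonneg
      have h2 := x.floor_add_one_le
      exact ⟨by linarith [hy.1], by linarith [hy.2]⟩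
    have fl : ∀ (x : D.Point) (y : ℝ), y ∈ Set.Ioo (⌊x.param⌋ : ℝ) (⌊x.param⌋ + 1) →
        ⌊y⌋ = ⌊x.param⌋ := fun x y hy => Int.floor_eq_iff.2 ⟨hy.1.le, hy.2⟩
    refine ⟨(⟨p.comp, _, mem p _ hα⟩, ⟨q.comp, _, mem q _ hβ⟩), ⟨?_, ?_⟩, rfl⟩
    · intro h
      simp only [Point.mk.injEq] at h
      exact hd h.1 h.2
    · have hpos : ∀ k, p.pos k = q.pos k → α * p.dir k = β * q.dir k →
          polygonPath (D.vertex p.comp) (p.param + ε * α) k =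
            polygonPath (D.vertex q.comp) (q.param + ε * β) k := by
        intro k hk hk'
        rw [polygonPath_apply_of_floor_eq _ (fl p _ hα), polygonPath_apply_of_floor_eq _ (fl q _ hβ)]
        change p.pos k + _ * p.dir k = q.pos k + _ * q.dir k
        linear_combination hk + ε * hk'
      exact ⟨hpos 0 c.sameProj.1 h0, hpos 1 c.sameProj.2 h1⟩
  · intro ε _ ε' _ h
    simp only [Prod.mk.injEq, add_right_inj] at h
    rcases hne with h' | h'
    · exact mul_right_cancel₀ h' h.1
    · exact mul_right_cancel₀ h' h.2

theorem Crossing.sign_eq (c : D.Crossing) : c.sign = 1 ∨ c.sign = -1 := by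
  rcases lt_or_gt_of_ne c.det_ne_zero with h | h
  · exact Or.inr (sign_neg h)
  · exact Or.inl (sign_pos h)

/-! ### The linking number as a signed count of overcrossings of one component -/

open Classical in
/-- The sum of the signs of the crossings at which the `i`-th component is above the `j`-th one. -/
noncomputable def overSum (D : LinkDiagram m) (i j : Fin m) : ℤ :=
  ∑ c : D.Crossing with c.overPt.comp = i ∧ c.underPt.comp = j, (c.sign : ℤ)

/-- The point of a crossing on the `i`-th component, if the `i`-th component is one of the two
components that meet there, and the crossing is not a self-crossing. -/
def Crossing.pointOn (i : Fin m) (c : D.Crossing) : D.Point :=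
  if c.overPt.comp = i then c.overPt else c.underPt

/-- The sign of the determinant of the directions of the `i`-th and the `j`-th component at a
crossing between them. -/
noncomputable def Crossing.planeSign (i j : Fin m) (c : D.Crossing) : SignType :=
  SignType.sign (cross ((c.pointOn i).dir 0, (c.pointOn i).dir 1)
    ((c.pointOn j).dir 0, (c.pointOn j).dir 1))

/-- The crossing is between the `i`-th and the `j`-th component. -/
def Crossing.Between (i j : Fin m) (c : D.Crossing) : Prop :=
  (c.overPt.comp = i ∧ c.underPt.comp = j) ∨ (c.overPt.comp = j ∧ c.underPt.comp = i)

section Between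

variable {i j : Fin m} {c c' : D.Crossing}

theorem Crossing.Between.comp_left (h : c.Between i j) : (c.pointOn i).comp = i := by
  unfold Crossing.pointOn
  rcases h with ⟨h1, h2⟩ | ⟨h1, h2⟩ <;> split_ifs <;> assumption

theorem Crossing.Between.symm (h : c.Between i j) : c.Between j i := Or.symm h

theorem Crossing.Between.sameProj (hij : i ≠ j) (h : c.Between i j) :
    SameProj (c.pointOn i) (c.pointOn j) := by
  unfold Crossing.pointOn
  rcases h with ⟨h1, h2⟩ | ⟨h1, h2⟩
  · simpa [h1, hij] using c.sameProj
  · simpa [h1, hij.symm] using c.sameProj.symm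

/-- `planeSign` orders the strands by component and `sign` by height, so the two agree or differ by
a minus sign. -/
theorem Crossing.planeSign_of_over (hij : i ≠ j) (h1 : c.overPt.comp = i) :
    c.planeSign i j = c.sign := by
  simp [Crossing.planeSign, Crossing.pointOn, Crossing.sign, h1, hij, cross]

theorem Crossing.planeSign_of_under (hij : i ≠ j) (h1 : c.overPt.comp = j) :
    c.planeSign i j = -c.sign := by
  simp only [Crossing.planeSign, Crossing.pointOn, Crossing.sign, h1, hij.symm, if_true, if_false]
  rw [← Left.sign_neg]
  congr 1
  simp only [cross]
  ring

theorem Crossing.Between.ext (hij : i ≠ j) (h : c.Between i j) (h' : c'.Between i j)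
    (hi : c.pointOn i = c'.pointOn i) (hj : c.pointOn j = c'.pointOn j) : c = c' := by
  have a := c.above
  have a' := c'.above
  unfold Crossing.pointOn at hi hj
  rcases h with ⟨h1, h2⟩ | ⟨h1, h2⟩ <;> rcases h' with ⟨h1', h2'⟩ | ⟨h1', h2'⟩ <;>
    simp only [h1, h1', hij, hij.symm, if_true, if_false] at hi hj
  · exact Crossing.ext hi hj
  · rw [hi, hj] at a
    exact absurd a a'.asymm
  · rw [hi, hj] at a
    exact absurd a a'.asymm
  · exact Crossing.ext hj hi

theorem exists_between_of_sameProj (hij : i ≠ j) {p q : D.Point} (hp : p.comp = i)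
    (hq : q.comp = j) (h : SameProj p q) :
    ∃ c : D.Crossing, c.Between i j ∧ c.pointOn i = p ∧ c.pointOn j = q := by
  have hpq : p ≠ q := by
    rintro rfl
    exact hij (hp.symm.trans hq)
  rcases lt_or_gt_of_ne (h.pos_two_ne hpq) with h2 | h2
  · exact ⟨⟨q, p, h.symm, h2⟩, Or.inr ⟨hq, hp⟩, by simp [Crossing.pointOn, hq, hij.symm],
      by simp [Crossing.pointOn, hq]⟩
  · exact ⟨⟨p, q, h, h2⟩, Or.inl ⟨hp, hq⟩, by simp [Crossing.pointOn, hp],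
      by simp [Crossing.pointOn, hp, hij]⟩

open Classical in
/-- The crossings between two given edges are counted by the number of turns of a parallelogram. -/
theorem sum_planeSign_edges (hij : i ≠ j) {a b : ℕ} (ha : a < D.len i) (hb : b < D.len j) :
    ∑ c : D.Crossing with c.Between i j ∧
        (⌊(c.pointOn i).param⌋₊, ⌊(c.pointOn j).param⌋₊) = (a, b), (c.planeSign i j : ℤ) =
      -turns (D.planeVertex i a - D.planeVertex j b)
        (D.planeVertex i (a + 1) - D.planeVertex i a)
        (D.planeVertex j b - D.planeVertex j (b + 1)) := by
  by_cases hex : ∃ c : D.Crossing, c.Between i j ∧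
      (⌊(c.pointOn i).param⌋₊, ⌊(c.pointOn j).param⌋₊) = (a, b)
  · obtain ⟨c, hc, hab⟩ := hex
    have data : ∀ c : D.Crossing, c.Between i j →
        (⌊(c.pointOn i).param⌋₊, ⌊(c.pointOn j).param⌋₊) = (a, b) →
        ∃ s ∈ Set.Ioo (0 : ℝ) 1, ∃ t ∈ Set.Ioo (0 : ℝ) 1,
          (c.pointOn i).param = a + s ∧ (c.pointOn j).param = b + t ∧
          (D.planeVertex i a - D.planeVertex j b) +
            s • (D.planeVertex i (a + 1) - D.planeVertex i a) +
            t • (D.planeVertex j b - D.planeVertex j (b + 1)) = 0 ∧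
          c.planeSign i j = SignType.sign (cross (D.planeVertex i (a + 1) - D.planeVertex i a)
            (D.planeVertex j (b + 1) - D.planeVertex j b)) := by
      intro c hc hab
      simp only [Prod.mk.injEq] at hab
      obtain ⟨a', -, s, hs, hps, hfs, ha', hpos, hdir⟩ := (c.pointOn i).exists_edge
      obtain ⟨b', -, t, ht, hpt, hft, hb', hpos', hdir'⟩ := (c.pointOn j).exists_edge
      obtain rfl : a' = a := ha'.symm.trans hab.1
      obtain rfl : b' = b := hb'.symm.trans hab.2
      have hsp := hc.sameProj hij
      have hne : c.pointOn i ≠ c.pointOn j := fun h => hij <| by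
        rw [← hc.comp_left, h, hc.symm.comp_left]
      have hs0 : s ≠ 0 := fun h => D.not_vertex _ _ hne hsp (hfs.trans h)
      have ht0 : t ≠ 0 := fun h => D.not_vertex _ _ hne.symm hsp.symm (hft.trans h)
      rw [hc.comp_left] at hpos hdir
      rw [hc.symm.comp_left] at hpos' hdir'
      refine ⟨s, ⟨lt_of_le_of_ne hs.1 hs0.symm, hs.2⟩, t, ⟨lt_of_le_of_ne ht.1 ht0.symm, ht.2⟩,
        hps, hpt, ?_, ?_⟩
      · have : ((c.pointOn i).pos 0, (c.pointOn i).pos 1) =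
            ((c.pointOn j).pos 0, (c.pointOn j).pos 1) := by rw [hsp.1, hsp.2]
        rw [hpos, hpos'] at this
        rw [← sub_eq_zero] at this
        rw [← this]
        module
      · rw [Crossing.planeSign, hdir, hdir']
    obtain ⟨s, hs, t, ht, hps, hpt, hz, hsign⟩ := data c hc hab
    have hcross : cross (D.planeVertex i (a + 1) - D.planeVertex i a)
        (D.planeVertex j b - D.planeVertex j (b + 1)) =
        -cross (D.planeVertex i (a + 1) - D.planeVertex i a)
          (D.planeVertex j (b + 1) - D.planeVertex j b) := by
      simp only [cross, Prod.fst_sub, Prod.snd_sub]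
      ring
    have hD : cross (D.planeVertex i (a + 1) - D.planeVertex i a)
        (D.planeVertex j b - D.planeVertex j (b + 1)) ≠ 0 := by
      rw [hcross]
      intro h0
      rw [neg_eq_zero] at h0
      rw [h0, sign_zero] at hsign
      have : c.sign = 0 := by
        rcases hc with h | h
        · rwa [Crossing.planeSign_of_over hij h.1] at hsign
        · rw [Crossing.planeSign_of_under hij h.1] at hsign
          revert hsign
          rcases c.sign with _ | _ | _ <;> decide
      rcases c.sign_eq with h | h <;> rw [this] at h <;> exact absurd h (by decide)
    rw [turns_eq_sign hs ht hz hD, hcross, Left.sign_neg, ← hsign]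
    rw [Finset.sum_eq_single_of_mem c (by simp [hc, Prod.mk.injEq, Prod.mk.inj hab])]
    · rcases c.planeSign i j with _ | _ | _ <;> decide
    · intro c' hc' hne
      exfalso
      apply hne
      simp only [Finset.mem_filter, Finset.mem_univ, true_and] at hc'
      obtain ⟨s', -, t', -, hps', hpt', hz', -⟩ := data c' hc'.1 hc'.2
      have z1 := congrArg Prod.fst (hz.trans hz'.symm)
      have z2 := congrArg Prod.snd (hz.trans hz'.symm)
      simp only [Prod.fst_add, Prod.snd_add, Prod.smul_fst, Prod.smul_snd, smul_eq_mul] at z1 z2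
      generalize D.planeVertex i (a + 1) - D.planeVertex i a = A at z1 z2 hD
      generalize D.planeVertex j b - D.planeVertex j (b + 1) = B at z1 z2 hD
      -- Cramer's rule: two nonparallel edges meet at most once.
      have hs' : s = s' := by
        refine sub_eq_zero.1 ((mul_eq_zero.1 ?_).resolve_right hD)
        simp only [cross]
        linear_combination B.2 * z1 - B.1 * z2
      have ht' : t = t' := by
        refine sub_eq_zero.1 ((mul_eq_zero.1 ?_).resolve_right hD)
        simp only [cross]
        linear_combination A.1 * z2 - A.2 * z1
      refine Crossing.Between.ext hij hc'.1 hc (Point.ext ?_ ?_) (Point.ext ?_ ?_)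
      · rw [hc.comp_left, hc'.1.comp_left]
      · rw [hps, hps', hs']
      · rw [hc.symm.comp_left, hc'.1.symm.comp_left]
      · rw [hpt, hpt', ht']
  · rw [Finset.sum_eq_zero, turns_eq_zero, neg_zero]
    · intro s hs t ht h0
      obtain ⟨p, hp, hpos, hpv⟩ := D.exists_point_on_edge ha hs
      obtain ⟨q, hq, hpos', hqv⟩ := D.exists_point_on_edge hb ht
      have heq : (p.pos 0, p.pos 1) = (q.pos 0, q.pos 1) := by
        rw [hpos, hpos', ← sub_eq_zero, ← h0]
        module
      have hsp : SameProj p q := ⟨congrArg Prod.fst heq, congrArg Prod.snd heq⟩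
      have hne : p ≠ q := by
        rintro rfl
        exact hij (hp.symm.trans hq)
      have hpv' := hpv.resolve_left (D.not_vertex _ _ hne hsp)
      have hqv' := hqv.resolve_left (D.not_vertex _ _ hne.symm hsp.symm)
      obtain ⟨c, hc, h1, h2⟩ := exists_between_of_sameProj hij hp hq hsp
      exact hex ⟨c, hc, by rw [h1, h2, hpv', hqv']⟩
    · intro c hc
      exact absurd ⟨c, (Finset.mem_filter.1 hc).2⟩ hex

end Between

-- This is the vanishing of the algebraic intersection number: crossings are grouped by the pair of
-- edges on which they lie.
open Classical in
theorem sum_planeSign_eq_zero {i j : Fin m} (hij : i ≠ j) :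
    ∑ c : D.Crossing with c.Between i j, (c.planeSign i j : ℤ) = 0 := by
  rw [← Finset.sum_fiberwise_of_maps_to (t := Finset.range (D.len i) ×ˢ Finset.range (D.len j))
    (g := fun c : D.Crossing => (⌊(c.pointOn i).param⌋₊, ⌊(c.pointOn j).param⌋₊))]
  · simp_rw [Finset.filter_filter]
    have h : ∀ x ∈ Finset.range (D.len i) ×ˢ Finset.range (D.len j),
        ∑ c : D.Crossing with c.Between i j ∧
          (⌊(c.pointOn i).param⌋₊, ⌊(c.pointOn j).param⌋₊) = x, (c.planeSign i j : ℤ) =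
        -turns (D.planeVertex i x.1 - D.planeVertex j x.2)
          (D.planeVertex i (x.1 + 1) - D.planeVertex i x.1)
          (D.planeVertex j x.2 - D.planeVertex j (x.2 + 1)) := by
      rintro ⟨a, b⟩ hx
      simp only [Finset.mem_product, Finset.mem_range] at hx
      exact sum_planeSign_edges hij hx.1 hx.2
    rw [Finset.sum_congr rfl h, Finset.sum_product, ← neg_eq_zero]
    simp_rw [Finset.sum_neg_distrib, neg_neg]
    exact sum_turns_eq_zero (planeVertex_len i) (planeVertex_len j)
  · intro c hc
    have hc' : c.Between i j := (Finset.mem_filter.1 hc).2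
    have hlt : ∀ p : D.Point, ⌊p.param⌋₊ < D.len p.comp := fun p =>
      (Nat.floor_lt p.param_mem.1).2 p.param_mem.2
    have h1 := hlt (c.pointOn i)
    have h2 := hlt (c.pointOn j)
    rw [hc'.comp_left] at h1
    rw [hc'.symm.comp_left] at h2
    simp [h1, h2]

open Classical in
theorem sum_between {i j : Fin m} (hij : i ≠ j) (f : D.Crossing → ℤ) :
    ∑ c : D.Crossing with c.Between i j, f c =
      ∑ c : D.Crossing with c.overPt.comp = i ∧ c.underPt.comp = j, f c +
        ∑ c : D.Crossing with c.overPt.comp = j ∧ c.underPt.comp = i, f c := by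
  rw [← Finset.sum_union]
  · congr 1
    ext c
    simp only [Finset.mem_union, Finset.mem_filter, Finset.mem_univ, true_and]
    exact Iff.rfl
  · rw [Finset.disjoint_filter]
    rintro c - h h'
    exact hij (h.1.symm.trans h'.1)

/-- Two components of a link cross over each other and under each other algebraically the same
number of times. -/
theorem overSum_comm (D : LinkDiagram m) {i j : Fin m} (hij : i ≠ j) :
    D.overSum i j = D.overSum j i := by
  classical
  have h := sum_planeSign_eq_zero (D := D) hij
  rw [sum_between hij] at h
  have h1 : ∑ c : D.Crossing with c.overPt.comp = i ∧ c.underPt.comp = j,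
      (c.planeSign i j : ℤ) = D.overSum i j := by
    unfold overSum
    refine Finset.sum_congr rfl fun c hc => ?_
    rw [Crossing.planeSign_of_over hij (Finset.mem_filter.1 hc).2.1]
  have h2 : ∑ c : D.Crossing with c.overPt.comp = j ∧ c.underPt.comp = i,
      (c.planeSign i j : ℤ) = -D.overSum j i := by
    unfold overSum
    rw [← Finset.sum_neg_distrib]
    refine Finset.sum_congr rfl fun c hc => ?_
    rw [Crossing.planeSign_of_under hij (Finset.mem_filter.1 hc).2.1]
    rcases c.sign with _ | _ | _ <;> decide
  rw [h1, h2] at h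
  linarith

theorem linkingNumber_eq_overSum (D : LinkDiagram m) {i j : Fin m} (hij : i ≠ j) :
    D.linkingNumber i j = D.overSum i j := by
  classical
  have h : (∑ᶠ c : {c : D.Crossing // (c.overPt.comp = i ∧ c.underPt.comp = j) ∨
      (c.overPt.comp = j ∧ c.underPt.comp = i)}, ((c.1.sign : ℤ) : ℚ)) =
      ((∑ c : D.Crossing with c.Between i j, (c.sign : ℤ) : ℤ) : ℚ) := by
    rw [finsum_eq_sum_of_fintype, Int.cast_sum]
    exact (Finset.sum_subtype (p := fun c : D.Crossing => c.Between i j) _ (by simp)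
      (fun c => ((c.sign : ℤ) : ℚ))).symm
  rw [linkingNumber, h, sum_between hij]
  change (((D.overSum i j + D.overSum j i : ℤ) : ℚ)) / 2 = _
  rw [← overSum_comm D hij]
  push_cast
  ring

end LinkDiagram

/-! ### The position on a component and the number of undercrossings passed -/

namespace LinkDiagram

open PolygonalLink

variable {m : ℕ} {D : LinkDiagram m}

theorem len_cast_pos (D : LinkDiagram m) (i : Fin m) : (0 : ℝ) < D.len i := by
  exact_mod_cast D.len_pos i

theorem IsUnder.of_crossing (c : D.Crossing) {i : Fin m} (hc : c.underPt.comp = i) :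
    D.IsUnder i c.underPt.param := ⟨c, hc, 0, by simp⟩

theorem isUnder_add_int_mul {i : Fin m} {s : ℝ} (k : ℤ) :
    D.IsUnder i (s + k * D.len i) ↔ D.IsUnder i s := by
  constructor
  · rintro ⟨c, hc, l, hl⟩
    exact ⟨c, hc, l - k, by push_cast; linarith⟩
  · rintro ⟨c, hc, l, hl⟩
    exact ⟨c, hc, l + k, by push_cast; linarith⟩

theorem isUnder_iff {i : Fin m} {s : ℝ} (hs : s ∈ Set.Ico 0 (D.len i : ℝ)) :
    D.IsUnder i s ↔ ∃ c : D.Crossing, c.underPt.comp = i ∧ c.underPt.param = s := by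
  constructor
  · rintro ⟨c, hc, k, hk⟩
    refine ⟨c, hc, ?_⟩
    have h := c.underPt.param_mem
    rw [hc] at h
    have hl := D.len_cast_pos i
    have a : (k : ℝ) < 1 := by
      by_contra h'
      nlinarith [h.1, h.2, hs.1, hs.2]
    have b : (-1 : ℝ) < k := by
      by_contra h'
      nlinarith [h.1, h.2, hs.1, hs.2]
    have a' : k < 1 := by exact_mod_cast a
    have b' : -1 < k := by exact_mod_cast b
    obtain rfl : k = 0 := by omega
    simpa using hk.symm
  · rintro ⟨c, hc, rfl⟩
    exact IsUnder.of_crossing c hc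

/-- Parameter `0` is a vertex, hence not a double point; this makes it usable as a base point. -/
theorem not_isUnder_zero (D : LinkDiagram m) (i : Fin m) : ¬ D.IsUnder i 0 := by
  rw [isUnder_iff ⟨le_rfl, D.len_cast_pos i⟩]
  rintro ⟨c, -, hc⟩
  refine D.not_vertex _ _ c.over_ne_under.symm c.sameProj.symm ?_
  simp [Point.IsVertex, hc]

theorem not_isUnder_len (D : LinkDiagram m) (i : Fin m) : ¬ D.IsUnder i (D.len i) := by
  have h := isUnder_add_int_mul (D := D) (i := i) (s := 0) 1
  simp only [Int.cast_one, one_mul, zero_add] at h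
  rw [h]
  exact D.not_isUnder_zero i

theorem Position.arc_add_int_mul {i : Fin m} {s : ℝ} (h : ¬ D.IsUnder i s) (k : ℤ) :
    Position.arc ⟨i, s + k * D.len i, (isUnder_add_int_mul k).not.2 h⟩ =
      Position.arc ⟨i, s, h⟩ := by
  have step : ∀ (t t' : ℝ) (ht : ¬ D.IsUnder i t) (ht' : ¬ D.IsUnder i t'), t' = t + D.len i →
      Position.arc ⟨i, t', ht'⟩ = Position.arc ⟨i, t, ht⟩ := fun t t' ht ht' h =>
    (Quot.sound ⟨rfl, Or.inr h⟩).symm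
  induction k with
  | zero => congr 2; simp
  | succ k ih => exact (step _ _ _ _ (by push_cast; ring)).trans ih
  | pred k ih => exact (step _ _ _ _ (by push_cast; ring)).symm.trans ih

theorem Arc.exists_position (a : D.Arc) : ∃ (i : Fin m) (s : ℝ) (h : ¬ D.IsUnder i s),
    s ∈ Set.Ico 0 (D.len i : ℝ) ∧ a = Position.arc ⟨i, s, h⟩ := by
  obtain ⟨⟨i, s, h⟩, rfl⟩ := Quot.exists_rep a
  have hl := D.len_cast_pos i
  have hs : s + (-⌊s / D.len i⌋ : ℤ) * D.len i = Int.fract (s / D.len i) * D.len i := by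
    rw [Int.fract]
    push_cast
    field_simp
    ring
  refine ⟨i, _, (isUnder_add_int_mul (-⌊s / D.len i⌋)).not.2 h, ?_,
    (Position.arc_add_int_mul h _).symm⟩
  rw [hs]
  exact ⟨mul_nonneg (Int.fract_nonneg _) hl.le, mul_lt_of_lt_one_left hl (Int.fract_lt_one _)⟩

/-- To prove a property of the points of a component, one goes along the component from the base
point and checks that the property persists at undercrossings. -/
theorem induction_on_param {i : Fin m} {P : ℝ → Prop} (zero : P 0)
    (stay : ∀ s t, s ≤ t → (∀ r ∈ Set.Icc s t, ¬ D.IsUnder i r) → P s → P t)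
    (pass : ∀ c : D.Crossing, c.underPt.comp = i → ∀ s t, s < c.underPt.param →
      c.underPt.param < t → (∀ r ∈ Set.Ico s c.underPt.param, ¬ D.IsUnder i r) →
      (∀ r ∈ Set.Ioc c.underPt.param t, ¬ D.IsUnder i r) → P s → P t)
    {s : ℝ} (hs : s ∈ Set.Icc 0 (D.len i : ℝ)) (hu : ¬ D.IsUnder i s) : P s := by
  classical
  let below : ℝ → Finset D.Crossing := fun s =>
    Finset.univ.filter fun c => c.underPt.comp = i ∧ c.underPt.param < s
  have hbelow : ∀ s c, c ∈ below s ↔ c.underPt.comp = i ∧ c.underPt.param < s := by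
    simp [below]
  have under : ∀ r ∈ Set.Icc 0 (D.len i : ℝ), D.IsUnder i r →
      ∃ c : D.Crossing, c.underPt.comp = i ∧ c.underPt.param = r := by
    intro r hr hru
    refine (isUnder_iff ⟨hr.1, hr.2.lt_of_ne ?_⟩).1 hru
    rintro rfl
    exact D.not_isUnder_len i hru
  -- The induction is on the number of undercrossings between the base point and `s`; `c` below is
  -- the last of them.
  induction hN : (below s).card using Nat.strong_induction_on generalizing s with
  | _ N ih =>
    rcases (below s).eq_empty_or_nonempty with he | hne
    · refine stay 0 s hs.1 (fun r hr hru => ?_) zero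
      obtain ⟨c, hc, rfl⟩ := under r ⟨hr.1, hr.2.trans hs.2⟩ hru
      have hlt : c.underPt.param < s := hr.2.lt_of_ne fun h => hu (h ▸ hru)
      have := (hbelow s c).2 ⟨hc, hlt⟩
      simp [he] at this
    · obtain ⟨c, hc, hmax⟩ := Finset.exists_max_image (below s) (fun c => c.underPt.param) hne
      obtain ⟨hci, hcs⟩ := (hbelow s c).1 hc
      have hcpos : 0 < c.underPt.param := c.underPt.param_mem.1.lt_of_ne fun h =>
        D.not_isUnder_zero i (h ▸ IsUnder.of_crossing c hci)
      -- A point `p` just before `c` and after all earlier undercrossings.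
      have hev : ∀ᶠ p in nhdsWithin c.underPt.param (Set.Iio c.underPt.param),
          0 < p ∧ p < c.underPt.param ∧ ∀ c' ∈ below c.underPt.param, c'.underPt.param < p := by
        refine ((lt_mem_nhds hcpos).filter_mono nhdsWithin_le_nhds).and
          (eventually_mem_nhdsWithin.and ?_)
        rw [Filter.eventually_all_finset]
        intro c' hc'
        exact (lt_mem_nhds ((hbelow _ c').1 hc').2).filter_mono nhdsWithin_le_nhds
      obtain ⟨p, hp0, hpc, hp⟩ := hev.exists
      have hno : ∀ r ∈ Set.Ico p c.underPt.param, ¬ D.IsUnder i r := by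
        intro r hr hru
        obtain ⟨c', hc', rfl⟩ :=
          under r ⟨hp0.le.trans hr.1, hr.2.le.trans (hcs.le.trans hs.2)⟩ hru
        exact (hp c' ((hbelow _ c').2 ⟨hc', hr.2⟩)).not_ge hr.1
      refine pass c hci p s hpc hcs hno (fun r hr hru => ?_) ?_
      · obtain ⟨c', hc', rfl⟩ := under r ⟨hcpos.le.trans hr.1.le, hr.2.trans hs.2⟩ hru
        have hlt : c'.underPt.param < s := hr.2.lt_of_ne fun h => hu (h ▸ hru)
        exact (hmax c' ((hbelow s c').2 ⟨hc', hlt⟩)).not_gt hr.1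
      · refine ih _ ?_ ⟨hp0.le, (hpc.trans hcs).le.trans hs.2⟩ (hno p ⟨le_rfl, hpc⟩) rfl
        rw [← hN]
        refine Finset.card_lt_card ⟨fun c' hc' => ?_, fun hsub => ?_⟩
        · obtain ⟨h1, h2⟩ := (hbelow p c').1 hc'
          exact (hbelow s c').2 ⟨h1, h2.trans (hpc.trans hcs)⟩
        · exact ((hbelow p c).1 (hsub hc)).2.not_gt hpc

/-! ### Weighted counts of undercrossings along a component -/

section Count

variable (w : D.Crossing → ℤ) {i : Fin m}

open Classical in
/-- The sum of the weights of the undercrossings passed on the way from the base point to the point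
with parameter `s`. -/
noncomputable def passed (w : D.Crossing → ℤ) (i : Fin m) (s : ℝ) : ℤ :=
  ∑ c : D.Crossing with c.underPt.comp = i, w c * ⌈(s - c.underPt.param) / D.len i⌉

open Classical in
/-- The sum of the weights of all undercrossings of a component. -/
noncomputable def total (w : D.Crossing → ℤ) (i : Fin m) : ℤ :=
  ∑ c : D.Crossing with c.underPt.comp = i, w c

/-- The ceiling tracks how many translates `a + k * l` have been passed, so it changes only if one
of them lies in `[s, t)`. -/
theorem ceil_eq_of_forall_not_mem {l a s t : ℝ} (hl : 0 < l) (hst : s ≤ t)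
    (h : ∀ k : ℤ, a + k * l ∉ Set.Ico s t) : ⌈(s - a) / l⌉ = ⌈(t - a) / l⌉ := by
  refine le_antisymm (Int.ceil_le_ceil (by gcongr)) ?_
  by_contra hlt
  push Not at hlt
  refine h ⌈(s - a) / l⌉ ⟨?_, ?_⟩
  · have := Int.le_ceil ((s - a) / l)
    rw [div_le_iff₀ hl] at this
    linarith
  · have := Int.lt_ceil.1 hlt
    rw [lt_div_iff₀ hl] at this
    linarith

theorem passed_zero : passed w i 0 = 0 := by
  refine Finset.sum_eq_zero fun c hc => ?_
  have hc : c.underPt.comp = i := (Finset.mem_filter.1 hc).2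
  have h := c.underPt.param_mem
  rw [hc] at h
  have hl := D.len_cast_pos i
  have : ⌈(0 - c.underPt.param) / D.len i⌉ = 0 := by
    rw [Int.ceil_eq_zero_iff]
    constructor
    · rw [lt_div_iff₀ hl]
      linarith [h.2]
    · exact div_nonpos_of_nonpos_of_nonneg (by linarith [h.1]) hl.le
  rw [this, mul_zero]

theorem passed_add_len (s : ℝ) : passed w i (s + D.len i) = passed w i s + total w i := by
  rw [passed, passed, total, ← Finset.sum_add_distrib]
  refine Finset.sum_congr rfl fun c _ => ?_
  have hl := D.len_cast_pos i
  have : (s + D.len i - c.underPt.param) / D.len i = (s - c.underPt.param) / D.len i + 1 := by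
    field_simp
    ring
  rw [this, Int.ceil_add_one]
  ring

theorem passed_eq_of_not_isUnder {s t : ℝ} (hst : s ≤ t)
    (h : ∀ r ∈ Set.Icc s t, ¬ D.IsUnder i r) : passed w i s = passed w i t := by
  refine Finset.sum_congr rfl fun c hc => ?_
  rw [ceil_eq_of_forall_not_mem (D.len_cast_pos i) hst fun k hk =>
    h _ (Set.Ico_subset_Icc_self hk) ⟨c, (Finset.mem_filter.1 hc).2, k, rfl⟩]

theorem passed_crossing {c : D.Crossing} (hc : c.underPt.comp = i) {s t : ℝ}
    (hs : s < c.underPt.param) (ht : c.underPt.param < t)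
    (h1 : ∀ r ∈ Set.Ico s c.underPt.param, ¬ D.IsUnder i r)
    (h2 : ∀ r ∈ Set.Ioc c.underPt.param t, ¬ D.IsUnder i r) :
    passed w i t = passed w i s + w c := by
  classical
  have hl := D.len_cast_pos i
  have hmem : c ∈ Finset.univ.filter fun c : D.Crossing => c.underPt.comp = i := by simp [hc]
  -- The distance from `s` to `c` is less than a period, as otherwise the preceding translate of `c`
  -- would lie in between; similarly for `t`.
  have hs' : ⌈(s - c.underPt.param) / D.len i⌉ = 0 := by
    rw [Int.ceil_eq_zero_iff]
    constructor
    · rw [lt_div_iff₀ hl]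
      by_contra hcon
      exact h1 (c.underPt.param + (-1 : ℤ) * D.len i)
        ⟨by push_cast; linarith, by push_cast; linarith⟩ ⟨c, hc, -1, rfl⟩
    · exact div_nonpos_of_nonpos_of_nonneg (by linarith) hl.le
  have ht' : ⌈(t - c.underPt.param) / D.len i⌉ = 1 := by
    rw [Int.ceil_eq_iff]
    constructor
    · push_cast
      rw [sub_self]
      exact div_pos (by linarith) hl
    · push_cast
      rw [div_le_iff₀ hl]
      by_contra hcon
      exact h2 (c.underPt.param + (1 : ℤ) * D.len i)
        ⟨by push_cast; linarith, by push_cast; linarith⟩ ⟨c, hc, 1, rfl⟩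
  rw [passed, passed, ← Finset.add_sum_erase _ _ hmem, ← Finset.add_sum_erase _ _ hmem, hs', ht']
  -- A translate of another undercrossing in `[s, t)` would have to coincide with `c`, and both
  -- parameters lie in one period.
  have hrest : ∀ c' ∈ (Finset.univ.filter fun c : D.Crossing => c.underPt.comp = i).erase c,
      w c' * ⌈(t - c'.underPt.param) / D.len i⌉ = w c' * ⌈(s - c'.underPt.param) / D.len i⌉ := by
    intro c' hc'
    obtain ⟨hne, hc'i⟩ := Finset.mem_erase.1 hc'
    have hc'i : c'.underPt.comp = i := (Finset.mem_filter.1 hc'i).2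
    rw [ceil_eq_of_forall_not_mem hl (hs.trans ht).le fun k hk => ?_]
    have hu : D.IsUnder i (c'.underPt.param + k * D.len i) := ⟨c', hc'i, k, rfl⟩
    rcases lt_trichotomy (c'.underPt.param + k * D.len i) c.underPt.param with h | h | h
    · exact h1 _ ⟨hk.1, h⟩ hu
    · apply hne
      apply Crossing.eq_of_underPt_eq
      refine Point.ext (hc'i.trans hc.symm) ?_
      have hm := c.underPt.param_mem
      have hm' := c'.underPt.param_mem
      rw [hc] at hm
      rw [hc'i] at hm'
      have a : (k : ℝ) < 1 := by
        by_contra h'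
        nlinarith [hm.1, hm.2, hm'.1, hm'.2]
      have b : (-1 : ℝ) < k := by
        by_contra h'
        nlinarith [hm.1, hm.2, hm'.1, hm'.2]
      have a' : k < 1 := by exact_mod_cast a
      have b' : -1 < k := by exact_mod_cast b
      obtain rfl : k = 0 := by omega
      simpa using h
    · exact h2 _ ⟨h, hk.2.le⟩ hu
  rw [Finset.sum_congr rfl hrest]
  ring

end Count

end LinkDiagram

/-! ### Colorings by `P_n^σ` -/

namespace PQuandle

variable {n : ℕ} {σ : Equiv.Perm (Fin n)}

/-- The element `0` of `P_n^σ`. -/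
def zero : PQuandle n σ := (0 : Fin (n + 1))

/-- The action of `0` on `P_n^σ`. -/
def zeroAct : Equiv.Perm (PQuandle n σ) where
  toFun := extend σ
  invFun := extend σ.symm
  left_inv := extend_symm_extend σ
  right_inv := extend_extend_symm σ

theorem zero_act (x : PQuandle n σ) : zero ◃ x = zeroAct x := by
  change star σ x zero = extend σ x
  exact if_pos rfl

theorem act_of_ne {y : PQuandle n σ} (h : y ≠ zero) (x : PQuandle n σ) : y ◃ x = x := by
  change star σ x y = x
  exact if_neg h

theorem zeroAct_zero : zeroAct (zero : PQuandle n σ) = zero := rfl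

theorem zeroAct_zpow_eq_zero (k : ℤ) {x : PQuandle n σ} :
    (zeroAct ^ k) x = zero ↔ x = zero := by
  have h : (zeroAct ^ k) (zero : PQuandle n σ) = zero :=
    Function.IsFixedPt.perm_zpow zeroAct_zero k
  conv_lhs => rw [← h]
  exact (zeroAct ^ k).injective.eq_iff

theorem act_eq_zero {x y : PQuandle n σ} : y ◃ x = zero ↔ x = zero := by
  by_cases hy : y = zero
  · rw [hy, zero_act]
    exact zeroAct_zpow_eq_zero 1
  · rw [act_of_ne hy]

end PQuandle

namespace LinkDiagram

open PolygonalLink PQuandle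

variable {m : ℕ} {D : LinkDiagram m} {n : ℕ} {σ : Equiv.Perm (Fin n)}

open Classical in
/-- The power of the action of `0` by which the color changes at an undercrossing, if the colors of
the base points are given. -/
noncomputable def weight (D : LinkDiagram m) (x : Fin m → PQuandle n σ) (c : D.Crossing) : ℤ :=
  if x c.overPt.comp = zero then (c.sign : ℤ) else 0

/-- The color of a point of the diagram in terms of the colors of the base points. -/
noncomputable def baseColor (D : LinkDiagram m) (x : Fin m → PQuandle n σ) (i : Fin m) (s : ℝ) :
    PQuandle n σ :=
  (zeroAct ^ passed (D.weight x) i s) (x i)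

theorem baseColor_eq_zero {x : Fin m → PQuandle n σ} {i : Fin m} {s : ℝ} :
    D.baseColor x i s = zero ↔ x i = zero :=
  zeroAct_zpow_eq_zero _

/-- The colors of the base points are compatible with a turn around each component. -/
def Admissible (D : LinkDiagram m) (x : Fin m → PQuandle n σ) : Prop :=
  ∀ i, (zeroAct ^ total (D.weight x) i) (x i) = x i

theorem baseColor_add_len {x : Fin m → PQuandle n σ} (hx : D.Admissible x) (i : Fin m) (s : ℝ) :
    D.baseColor x i (s + D.len i) = D.baseColor x i s := by
  rw [baseColor, passed_add_len, zpow_add, Equiv.Perm.mul_apply, hx i, baseColor]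

theorem baseColor_crossing (x : Fin m → PQuandle n σ) {c : D.Crossing} {i : Fin m}
    (hc : c.underPt.comp = i) {s t : ℝ} (hs : s < c.underPt.param) (ht : c.underPt.param < t)
    (h1 : ∀ r ∈ Set.Ico s c.underPt.param, ¬ D.IsUnder i r)
    (h2 : ∀ r ∈ Set.Ioc c.underPt.param t, ¬ D.IsUnder i r) :
    D.baseColor x i t = (zeroAct ^ D.weight x c) (D.baseColor x i s) := by
  rw [baseColor, passed_crossing _ hc hs ht h1 h2, add_comm, zpow_add, Equiv.Perm.mul_apply,
    baseColor]

/-- The coloring with given colors of the base points. -/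
noncomputable def coloringOfBase (x : Fin m → PQuandle n σ) (hx : D.Admissible x) :
    D.Coloring (PQuandle n σ) where
  color := Quot.lift (fun p => D.baseColor x p.comp p.param) (by
    rintro ⟨i, s, h⟩ ⟨j, t, h'⟩ ⟨hij, hrel⟩
    simp only at hij hrel ⊢
    subst hij
    rcases hrel with ⟨hst, hno⟩ | rfl
    · rw [baseColor, passed_eq_of_not_isUnder _ hst hno, baseColor]
    · exact (baseColor_add_len hx _ _).symm)
  positive := by
    rintro c _ _ ⟨⟨i, s, hs⟩, hi, hsc, hno, rfl⟩ ⟨⟨j, t, ht⟩, hj, hct, hno', rfl⟩ hsign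
    simp only at hi hj hsc hct hno hno'
    subst hi hj
    change D.baseColor x _ t = D.baseColor x _ _ ◃ D.baseColor x _ s
    rw [baseColor_crossing x rfl hsc hct hno hno', weight, hsign]
    -- The over arc is colored `0` iff the base point of its component is, which is why `weight`
    -- consults only base colors.
    split_ifs with h
    · rw [baseColor_eq_zero.2 h, zero_act]
      rfl
    · rw [act_of_ne (baseColor_eq_zero.not.2 h)]
      rfl
  negative := by
    rintro c _ _ ⟨⟨i, s, hs⟩, hi, hsc, hno, rfl⟩ ⟨⟨j, t, ht⟩, hj, hct, hno', rfl⟩ hsign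
    simp only at hi hj hsc hct hno hno'
    subst hi hj
    change D.baseColor x _ s = D.baseColor x _ _ ◃ D.baseColor x _ t
    rw [baseColor_crossing x rfl hsc hct hno hno', weight, hsign]
    split_ifs with h
    · rw [baseColor_eq_zero.2 h, zero_act]
      exact ((zeroAct : Equiv.Perm (PQuandle n σ)).apply_symm_apply _).symm
    · rw [act_of_ne (baseColor_eq_zero.not.2 h)]
      rfl

/-- The color of the base point of a component. -/
def Coloring.atBase {X : Type*} [Quandle X] (C : D.Coloring X) (i : Fin m) : X :=
  C.color (Position.arc ⟨i, 0, D.not_isUnder_zero i⟩)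

theorem Coloring.color_eq_of_not_isUnder {X : Type*} [Quandle X] (C : D.Coloring X) {i : Fin m}
    {s t : ℝ} (hst : s ≤ t) (h : ∀ r ∈ Set.Icc s t, ¬ D.IsUnder i r) (hs : ¬ D.IsUnder i s)
    (ht : ¬ D.IsUnder i t) :
    C.color (Position.arc ⟨i, t, ht⟩) = C.color (Position.arc ⟨i, s, hs⟩) :=
  congrArg C.color (Quot.sound ⟨rfl, Or.inl ⟨hst, h⟩⟩).symm

/-! ### Colorings are determined by their base colors -/

section

variable (C : D.Coloring (PQuandle n σ))

/-- Crossings preserve being `0` in both directions. This has to precede `color_eq_baseColor`, whose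
weights read the color of an over arc off its base point. -/
theorem Coloring.color_eq_zero_iff {i : Fin m} {s : ℝ} (hs : s ∈ Set.Icc 0 (D.len i : ℝ))
    (hu : ¬ D.IsUnder i s) :
    C.color (Position.arc ⟨i, s, hu⟩) = zero ↔ C.atBase i = zero := by
  suffices h : ∀ hu : ¬ D.IsUnder i s,
      C.color (Position.arc ⟨i, s, hu⟩) = zero ↔ C.atBase i = zero from h hu
  refine induction_on_param (i := i) (P := fun s => ∀ hu : ¬ D.IsUnder i s,
    C.color (Position.arc ⟨i, s, hu⟩) = zero ↔ C.atBase i = zero) (fun _ => Iff.rfl)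
    ?_ ?_ hs hu
  · intro s t hst hno ih ht
    rw [C.color_eq_of_not_isUnder hst hno (hno s ⟨le_rfl, hst⟩) ht]
    exact ih _
  · intro c hc s t hsc ht h1 h2 ih hu
    subst hc
    have hu' := h1 s ⟨le_rfl, hsc⟩
    have hin : c.IsIncoming (Position.arc ⟨_, s, hu'⟩) := ⟨_, rfl, hsc, h1, rfl⟩
    have hout : c.IsOutgoing (Position.arc ⟨_, t, hu⟩) := ⟨_, rfl, ht, h2, rfl⟩
    rw [← ih hu']
    rcases c.sign_eq with h | h
    · rw [C.positive c _ _ hin hout h, act_eq_zero]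
    · rw [C.negative c _ _ hin hout h, act_eq_zero]

theorem Coloring.color_eq_baseColor {i : Fin m} {s : ℝ} (hs : s ∈ Set.Icc 0 (D.len i : ℝ))
    (hu : ¬ D.IsUnder i s) :
    C.color (Position.arc ⟨i, s, hu⟩) = D.baseColor C.atBase i s := by
  suffices h : ∀ hu : ¬ D.IsUnder i s,
      C.color (Position.arc ⟨i, s, hu⟩) = D.baseColor C.atBase i s from h hu
  refine induction_on_param (i := i) (P := fun s => ∀ hu : ¬ D.IsUnder i s,
    C.color (Position.arc ⟨i, s, hu⟩) = D.baseColor C.atBase i s) (fun _ => ?_)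
    ?_ ?_ hs hu
  · rw [baseColor, passed_zero]
    rfl
  · intro s t hst hno ih ht
    rw [C.color_eq_of_not_isUnder hst hno (hno s ⟨le_rfl, hst⟩) ht, ih, baseColor,
      passed_eq_of_not_isUnder _ hst hno, baseColor]
  · intro c hc s t hsc ht h1 h2 ih hu
    subst hc
    have hu' := h1 s ⟨le_rfl, hsc⟩
    have hin : c.IsIncoming (Position.arc ⟨_, s, hu'⟩) := ⟨_, rfl, hsc, h1, rfl⟩
    have hout : c.IsOutgoing (Position.arc ⟨_, t, hu⟩) := ⟨_, rfl, ht, h2, rfl⟩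
    have hover : C.color c.overArc = zero ↔ C.atBase c.overPt.comp = zero :=
      C.color_eq_zero_iff (Set.Ico_subset_Icc_self c.overPt.param_mem) c.over_not_under
    rw [baseColor_crossing _ rfl hsc ht h1 h2, ← ih hu', weight]
    rcases c.sign_eq with h | h
    · rw [C.positive c _ _ hin hout h, h]
      split_ifs with h0
      · rw [hover.2 h0, zero_act]
        rfl
      · rw [act_of_ne (hover.not.2 h0)]
        rfl
    · rw [C.negative c _ _ hin hout h, h]
      split_ifs with h0
      · rw [hover.2 h0, zero_act]
        exact ((zeroAct : Equiv.Perm (PQuandle n σ)).symm_apply_apply _).symm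
      · rw [act_of_ne (hover.not.2 h0)]
        rfl

/-- The parameters `0` and `len i` lie on the same arc, so the color after a full turn is the base
color. -/
theorem Coloring.admissible : D.Admissible C.atBase := by
  intro i
  have h1 := C.color_eq_baseColor ⟨(D.len_cast_pos i).le, le_rfl⟩ (D.not_isUnder_len i)
  have h2 : passed (D.weight C.atBase) i (D.len i) = total (D.weight C.atBase) i := by
    have := passed_add_len (D.weight C.atBase) (i := i) 0
    rwa [zero_add, passed_zero, zero_add] at this
  rw [baseColor, h2] at h1
  rw [← h1]
  refine congrArg C.color (Quot.sound ⟨rfl, Or.inr ?_⟩).symm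
  simp

end

/-- A coloring by `P_n^σ` is given by the colors of the base points. -/
noncomputable def coloringEquiv (D : LinkDiagram m) (n : ℕ) (σ : Equiv.Perm (Fin n)) :
    D.Coloring (PQuandle n σ) ≃ {x : Fin m → PQuandle n σ // D.Admissible x} where
  toFun C := ⟨C.atBase, C.admissible⟩
  invFun x := coloringOfBase x.1 x.2
  left_inv C := by
    ext a
    obtain ⟨i, s, h, hs, rfl⟩ := a.exists_position
    exact (C.color_eq_baseColor (Set.Ico_subset_Icc_self hs) h).symm
  right_inv x := by
    ext i
    change D.baseColor x.1 i 0 = x.1 i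
    rw [baseColor, passed_zero]
    rfl

/-! ### Comparing the colorings of two diagrams -/

open Classical in
theorem total_weight (x : Fin m → PQuandle n σ) (i : Fin m) :
    total (D.weight x) i = ∑ j, if x j = zero then D.overSum j i else 0 := by
  rw [total, ← Finset.sum_fiberwise (g := fun c : D.Crossing => c.overPt.comp)]
  refine Finset.sum_congr rfl fun j _ => ?_
  rw [Finset.filter_filter, overSum]
  split_ifs with h
  · refine Finset.sum_congr ?_ fun c hc => ?_
    · ext c
      simp [and_comm]
    · rw [weight, if_pos]
      rwa [(Finset.mem_filter.1 hc).2.1]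
  · refine Finset.sum_eq_zero fun c hc => ?_
    rw [weight, if_neg]
    rwa [(Finset.mem_filter.1 hc).2.2]

/-- Only `i ≠ j` matters: a component colored `0` satisfies its condition because `0` is fixed, and
on any other component self-crossings have weight `0`. -/
theorem admissible_iff_of_overSum_eq {D D' : LinkDiagram m}
    (h : ∀ i j, i ≠ j → D.overSum i j = D'.overSum i j) (x : Fin m → PQuandle n σ) :
    D.Admissible x ↔ D'.Admissible x := by
  classical
  refine forall_congr' fun i => ?_
  by_cases hi : x i = zero
  · rw [hi]
    exact iff_of_true ((zeroAct_zpow_eq_zero _).2 rfl) ((zeroAct_zpow_eq_zero _).2 rfl)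
  · have : total (D.weight x) i = total (D'.weight x) i := by
      rw [total_weight, total_weight]
      refine Finset.sum_congr rfl fun j _ => ?_
      split_ifs with hj
      · refine h j i ?_
        rintro rfl
        exact hi hj
      · rfl
    rw [this]

/-- Diagrams whose components have the same pairwise linking numbers have isomorphic quivers. -/
theorem nonempty_quiverIso {D D' : LinkDiagram m}
    (h : ∀ i j, i ≠ j → D.linkingNumber i j = D'.linkingNumber i j)
    (S : Set (PQuandle n σ →◃ PQuandle n σ)) :
    Nonempty (QuiverIso (D.QuandleQuiver (PQuandle n σ) S)
      (D'.QuandleQuiver (PQuandle n σ) S)) := by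
  have hsum : ∀ i j, i ≠ j → D.overSum i j = D'.overSum i j := by
    intro i j hij
    have := h i j hij
    rw [linkingNumber_eq_overSum D hij, linkingNumber_eq_overSum D' hij] at this
    exact_mod_cast this
  let φ : D.Coloring (PQuandle n σ) ≃ D'.Coloring (PQuandle n σ) :=
    (D.coloringEquiv n σ).trans ((Equiv.subtypeEquivRight
      (admissible_iff_of_overSum_eq hsum)).trans (D'.coloringEquiv n σ).symm)
  have hφ : ∀ C, (φ C).atBase = C.atBase := by
    intro C
    exact congrArg Subtype.val ((D'.coloringEquiv n σ).apply_symm_apply _)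
  -- An endomorphism acts on base colors coordinatewise, and `φ` keeps base colors, so the two
  -- commute.
  have hmap : ∀ (f : PQuandle n σ →◃ PQuandle n σ) (C : D.Coloring (PQuandle n σ)),
      φ (C.map f) = (φ C).map f := by
    intro f C
    apply (D'.coloringEquiv n σ).injective
    apply Subtype.ext
    funext i
    change (φ (C.map f)).atBase i = f ((φ C).atBase i)
    rw [hφ, hφ]
    rfl
  -- An edge is sent to the edge with the same label `f`.
  exact ⟨⟨φ, fun v w => Equiv.subtypeEquivRight fun f =>
    φ.injective.eq_iff.symm.trans (by rw [hmap f.1 v]; rfl)⟩⟩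

end LinkDiagram

theorem mainTheorem5 (n : ℕ) (σ : Equiv.Perm (Fin n)) (S : Set (PQuandle n σ →◃ PQuandle n σ))
    (D D' : LinkDiagram 2) (h : D.linkingNumber 0 1 = D'.linkingNumber 0 1) :
    Nonempty (QuiverIso (D.QuandleQuiver (PQuandle n σ) S)
      (D'.QuandleQuiver (PQuandle n σ) S)) := by
  have comm : ∀ E : LinkDiagram 2, E.linkingNumber 1 0 = E.linkingNumber 0 1 := by
    intro E
    rw [E.linkingNumber_eq_overSum (by decide), E.linkingNumber_eq_overSum (by decide),
      E.overSum_comm (by decide)]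
  refine LinkDiagram.nonempty_quiverIso (fun i j hij => ?_) S
  fin_cases i <;> fin_cases j
  · exact absurd rfl hij
  · exact h
  · exact (comm D).trans (h.trans (comm D').symm)
  · exact absurd rfl hij
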